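/- Fix integers $1\le s\le d$ and reals $0<\varepsilon\le\Delta\le R$, $0<\eta<1$. An $s$-sparse $\varepsilon$-misspecified linear bandit instance consists of finitely many (at least one) pairwise distinct actions, which are feature vectors $a\in\mathbb{R}^d$ with $\|a\|_2\le 1$, a parameter $\theta^*\in\mathbb{R}^d$ with exactly $s$ nonzero entries and $\|\theta^*\|_2\le R$ (the usual normalization is $R=1$), and deterministic rewards $r_a=\langle a,\theta^*\rangle+\nu_a$ with $|\nu_a|\le\varepsilon$. A (randomized, adaptive) algorithm knows the feature vectors and the parameters $d,s,\varepsilon,\Delta,R,\eta$, queries rewards of actions one at a time, each choice depending on its random seed and on the rewards seen so far, and may halt and return an action $\hat a$. It is $(\eta,\Delta)$-sound if on every such instance, with probability at least $1-\eta$, it halts and returns an action with $r_{\hat a}\ge\max_x r_x-\Delta$. **Theorem.** For every constant $C'>0$ there are constants $c_0,c_1>0$, depending only on $C'$, such that for all $d,s,\varepsilon,\Delta,R,\eta$ as above and every $(\eta,\Delta)$-sound algorithm $\mathcal{A}$ there is an $s$-sparse $\varepsilon$-misspecified linear bandit instance on which the expected number of actions that $\mathcal{A}$ takes, that is, its expected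 number of queries plus one for the returned action (infinite when it never halts), is at least $$(1-\eta)\exp\Bigl(c_0\,d\,\bigl(\tfrac{\varepsilon}{\Delta}\bigr)^2\Bigr)\ \text{ if } \tfrac{\varepsilon}{\Delta}\le\tfrac{C's}{d},\qquad (1-\eta)\exp\Bigl(c_1\,s\,\tfrac{\varepsilon}{\Delta}\Bigr)\ \text{ if } \tfrac{\varepsilon}{\Delta}>\tfrac{C's}{d}.$$ In particular, if $\Delta\le K s^{\delta}\varepsilon$ with $K>0$, $0<\delta<1$ and $d>C'K s^{1+\delta}$, then this number is at least $(1-\eta)\exp\bigl(\tfrac{c_1}{K}s^{1-\delta}\bigr)$. -/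

import Mathlib

open MeasureTheory
open scoped ENNReal

namespace MisspecifiedBandit

/-- An `s`-sparse `ε`-misspecified linear bandit instance in dimension `d` whose parameter has
Euclidean norm at most `R`. The actions are the (pairwise distinct) rows `Φ 0, …, Φ k` of a feature
matrix, indexed by the nonempty type `Fin (k + 1)`; the reward of action `a` is
`⟪Φ a, θ⟫ + ν a` with `|ν a| ≤ ε`. -/
structure Instance (d s : ℕ) (ε R : ℝ) where
  k : ℕ
  Φ : Fin (k + 1) → EuclideanSpace ℝ (Fin d)
  Φ_injective : Function.Injective Φ
  Φ_norm_le : ∀ a, ‖Φ a‖ ≤ 1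
  θ : EuclideanSpace ℝ (Fin d)
  θ_sparse : (Finset.univ.filter fun j => θ j ≠ 0).card = s
  θ_norm_le : ‖θ‖ ≤ R
  ν : Fin (k + 1) → ℝ
  ν_le : ∀ a, |ν a| ≤ ε

/-- The deterministic reward of an action. -/
noncomputable def Instance.reward {d s : ℕ} {ε R : ℝ} (I : Instance d s ε R)
    (a : Fin (I.k + 1)) : ℝ :=
  inner ℝ (I.Φ a) I.θ + I.ν a

/-- What a learner does next: query the reward of an action, or halt and return an action. -/
inductive Move (α : Type) where
  | query (a : α) : Move α
  | halt (a : α) : Move α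

/-- The list of (action, observed reward) pairs, most recent first, after at most `t` queries, when
the strategy `p` is run against the rewards `r`. It no longer changes once `p` halts. -/
def history {α : Type} (p : List (α × ℝ) → Move α) (r : α → ℝ) : ℕ → List (α × ℝ)
  | 0 => []
  | t + 1 =>
    match p (history p r t) with
    | Move.query a => (a, r a) :: history p r t
    | Move.halt _ => history p r t

/-- Run against the rewards `r`, the strategy `p` eventually halts and returns the action `a`. -/
def Returns {α : Type} (p : List (α × ℝ) → Move α) (r : α → ℝ) (a : α) : Prop :=
  ∃ t, p (history p r t) = Move.halt a

/-- The total number of queries made by `p` against the rewards `r` (`⊤` if it never halts). -/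
noncomputable def numQueries {α : Type} (p : List (α × ℝ) → Move α) (r : α → ℝ) : ℕ∞ :=
  ⨆ t, ((history p r t).length : ℕ∞)

/-- A randomized, adaptive bandit algorithm with random seed in `Ω`: it is given the feature matrix
and the seed, and chooses each move from the actions queried and the rewards observed so far. -/
structure Algorithm (d : ℕ) (Ω : Type*) [MeasurableSpace Ω] where
  step : (k : ℕ) → (Fin (k + 1) → EuclideanSpace ℝ (Fin d)) → Ω →
    List (Fin (k + 1) × ℝ) → Move (Fin (k + 1))
  measurable_step : ∀ k Φ h m, MeasurableSet {ω | step k Φ ω h = m}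

/-- `A` is `(η, Δ)`-sound for the class of `s`-sparse `ε`-misspecified instances: on every such
instance, with probability at least `1 - η`, it halts and returns a `Δ`-optimal action. -/
def Algorithm.Sound {d : ℕ} {Ω : Type*} [MeasurableSpace Ω] (A : Algorithm d Ω) (μ : Measure Ω)
    (s : ℕ) (ε R η Δ : ℝ) : Prop :=
  ∀ I : Instance d s ε R,
    ENNReal.ofReal (1 - η) ≤
      μ {ω | ∃ a, Returns (A.step I.k I.Φ ω) I.reward a ∧ ∀ x, I.reward x - Δ ≤ I.reward a}

/-- The expected number of queries that `A` makes on the instance `I`. -/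
noncomputable def Algorithm.expectedQueries {d : ℕ} {Ω : Type*} [MeasurableSpace Ω]
    (A : Algorithm d Ω) (μ : Measure Ω) {s : ℕ} {ε R : ℝ} (I : Instance d s ε R) : ℝ≥0∞ :=
  ∫⁻ ω, ((numQueries (A.step I.k I.Φ ω) I.reward : ℕ∞) : ℝ≥0∞) ∂μ

end MisspecifiedBandit

/-! The hard instances hide a needle in a haystack. Put `τ = ε / Δ` and take about `exp E` unit
`s`-sparse vectors whose pairwise inner products are below `τ` in absolute value, where `E = min (d
τ² / 8) (s τ / 2)`. With parameter `Δ v i`, misspecification `ε` is enough to cancel every reward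
except that of `i`, which it raises to `Δ + ε` (`needleInstance`). Only `i` is then `Δ`-optimal, and
every other query returns zero, so finding `i` takes a number of moves linear in the number of
vectors, on average over `i` (`Algorithm.exists_card_mul_le_two_mul_queries`).

The vectors (`exists_incoherent_sparse_vectors`) come from a greedy packing of random words: cut the
coordinates into `s` blocks and put one signed basis vector in each. A Chernoff bound shows that few
words correlate with a given one.

This gives `(1 - η) exp E / 4`. To absorb the factor `1 / 4`, the exponent is cut to `E / 3`, which
suffices once `exp (E / 3) ≥ 2`. Otherwise it is enough to show `2 (1 - η)` moves: with actions `u`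
and `-u`, halting at once cannot be right for both signs of the parameter
(`Algorithm.Sound.exists_two_mul_le`). -/

namespace MisspecifiedBandit

/-! ### Deterministic runs of a strategy -/

section Runs

variable {α : Type} (p : List (α × ℝ) → Move α) (r : α → ℝ)

lemma history_succ_of_query {t : ℕ} {a : α} (h : p (history p r t) = Move.query a) :
    history p r (t + 1) = (a, r a) :: history p r t := by
  simp [history, h]

lemma history_succ_of_halt {t : ℕ} {a : α} (h : p (history p r t) = Move.halt a) :
    history p r (t + 1) = history p r t := by
  simp [history, h]

lemma history_add_of_halt {t : ℕ} {a : α} (h : p (history p r t) = Move.halt a) (u : ℕ) :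
    history p r (t + u) = history p r t := by
  induction u with
  | zero => rfl
  | succ u ih =>
    rw [← add_assoc, history_succ_of_halt p r (a := a) (by rw [ih, h]), ih]

variable {p r} in
lemma Returns.eq_of_halt {a b : α} {t : ℕ} (hb : Returns p r b)
    (h : p (history p r t) = Move.halt a) : b = a := by
  obtain ⟨u, hu⟩ := hb
  rcases le_total t u with htu | htu
  · obtain ⟨v, rfl⟩ := Nat.exists_eq_add_of_le htu
    rw [history_add_of_halt p r h, h] at hu
    exact (Move.halt.inj hu).symm
  · obtain ⟨v, rfl⟩ := Nat.exists_eq_add_of_le htu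
    rw [history_add_of_halt p r hu, hu] at h
    exact Move.halt.inj h

lemma length_history_eq_or_halt (t : ℕ) :
    (history p r t).length = t ∨
      ((history p r t).length < t ∧ ∃ a, p (history p r t) = Move.halt a) := by
  induction t with
  | zero => simp [history]
  | succ t ih =>
    rcases hp : p (history p r t) with a | a
    · rw [history_succ_of_query p r hp]
      rcases ih with ih | ⟨-, b, hb⟩
      · simp [ih]
      · simp [hp] at hb
    · rw [history_succ_of_halt p r hp]
      right
      exact ⟨by omega, a, hp⟩

lemma length_history_le_numQueries (t : ℕ) :
    ((history p r t).length : ℕ∞) ≤ numQueries p r :=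
  le_iSup (fun t => ((history p r t).length : ℕ∞)) t

/-- Two reward functions that differ only at an action not yet queried are indistinguishable. -/
lemma history_congr_of_notMem {r₀ : α → ℝ} {i : α} (hr : ∀ a, a ≠ i → r a = r₀ a) {t : ℕ}
    (hi : i ∉ (history p r₀ t).map Prod.fst) : history p r t = history p r₀ t := by
  induction t with
  | zero => rfl
  | succ t ih =>
    rcases hp : p (history p r₀ t) with a | a
    · rw [history_succ_of_query p r₀ hp] at hi ⊢
      simp only [List.map_cons, List.mem_cons, not_or] at hi
      have h := ih hi.2
      rw [history_succ_of_query p r (a := a) (by rw [h, hp]), h, hr a (Ne.symm hi.1)]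
    · rw [history_succ_of_halt p r₀ hp] at hi ⊢
      have h := ih hi
      rw [history_succ_of_halt p r (a := a) (by rw [h, hp]), h]

end Runs

/-! ### Needle search for a fixed seed -/

section Needle

variable {α : Type}

/-- Among the rewards that differ from `r₀` at one action only, a strategy that finds `m` of the
exceptional actions needs more than `n` moves on all but `n` of these rewards, for each `n < m`. -/
lemma card_numQueries_lt_le (p : List (α × ℝ) → Move α) (r₀ : α → ℝ) (r : α → α → ℝ)
    (hr : ∀ i a, a ≠ i → r i a = r₀ a) (S : Finset α) (hS : ∀ i ∈ S, Returns p (r i) i)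
    {n : ℕ} (hn : n < S.card) (T : Finset α) (hT : ∀ i ∈ T, numQueries p (r i) + 1 ≤ n) :
    T.card ≤ n := by
  classical
  have hcard : ((history p r₀ n).map Prod.fst).toFinset.card ≤ (history p r₀ n).length :=
    (List.toFinset_card_le _).trans (by simp)
  rcases length_history_eq_or_halt p r₀ n with h | ⟨h, a, ha⟩
  · refine (Finset.card_le_card fun i hi => ?_).trans (hcard.trans h.le)
    by_contra hni
    rw [List.mem_toFinset] at hni
    have h1 := length_history_le_numQueries p (r i) n
    rw [history_congr_of_notMem p (r i) (hr i) hni, h] at h1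
    have h2 : (n : ℕ∞) + 1 ≤ n := (add_le_add_left h1 1).trans (hT i hi)
    norm_cast at h2
    omega
  -- An early halt names one action besides the fewer than `n` queried ones, so at most `n` needles
  -- are found, against `n < S.card`.
  · have hsub : S ⊆ insert a ((history p r₀ n).map Prod.fst).toFinset := fun i hi => by
      rw [Finset.mem_insert, List.mem_toFinset]
      by_contra! hni
      have h1 := history_congr_of_notMem p (r i) (hr i) hni.2
      exact hni.1 ((hS i hi).eq_of_halt (by rw [h1, ha]))
    have := (Finset.card_le_card hsub).trans (Finset.card_insert_le _ _)
    omega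

lemma mul_le_two_mul_sum_range_sub {m N : ℕ} (h : m ≤ N) :
    N * m ≤ 2 * ∑ n ∈ Finset.range m, (N - n) := by
  have key : ∀ m ≤ N, m * N + m * (N - m) + m = 2 * ∑ n ∈ Finset.range m, (N - n) := by
    intro m
    induction m with
    | zero => simp
    | succ m ih =>
      intro h
      rw [Finset.sum_range_succ, mul_add, ← ih (by omega)]
      obtain ⟨q, rfl⟩ := Nat.exists_eq_add_of_le h
      have h1 : m + 1 + q - (m + 1) = q := by omega
      have h2 : m + 1 + q - m = q + 1 := by omega
      rw [h1, h2]
      ring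
  rw [← key m h, mul_comm]
  omega

/-- Layer-cake summation: a cost is at least the number of levels `n < S.card` below it, and at each
such level all but `n` actions have cost above `n`. Truncating at `S.card` also handles infinite
costs. -/
lemma card_mul_card_le_two_mul_sum_numQueries [Fintype α] (p : List (α × ℝ) → Move α) (r₀ : α → ℝ)
    (r : α → α → ℝ) (hr : ∀ i a, a ≠ i → r i a = r₀ a) (S : Finset α)
    (hS : ∀ i ∈ S, Returns p (r i) i) :
    ((Fintype.card α * S.card : ℕ) : ℕ∞) ≤ 2 * ∑ i, (numQueries p (r i) + 1) := by
  classical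
  set c : α → ℕ∞ := fun i => numQueries p (r i) + 1 with hc
  have h1 : ∀ i, (((Finset.range S.card).filter fun n : ℕ => (n : ℕ∞) < c i).card : ℕ∞) ≤ c i := by
    intro i
    rcases h : c i with _ | x
    · exact le_top
    · have hsub : ((Finset.range S.card).filter fun n : ℕ => (n : ℕ∞) < (x : ℕ)) ⊆ Finset.range x :=
        fun n hn => by
          have := (Finset.mem_filter.1 hn).2
          exact Finset.mem_range.2 (by exact_mod_cast this)
      have := Finset.card_le_card hsub
      rw [Finset.card_range] at this
      exact Nat.cast_le.2 this
  have h2 : ∑ n ∈ Finset.range S.card, (Fintype.card α - n) ≤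
      ∑ i, ((Finset.range S.card).filter fun n : ℕ => (n : ℕ∞) < c i).card := by
    simp_rw [Finset.card_filter]
    rw [Finset.sum_comm]
    refine Finset.sum_le_sum fun n hn => ?_
    rw [← Finset.card_filter]
    have h3 := card_numQueries_lt_le p r₀ r hr S hS (Finset.mem_range.1 hn)
      (Finset.univ.filter fun i => ¬ (n : ℕ∞) < c i)
      (fun i hi => not_lt.1 (Finset.mem_filter.1 hi).2)
    have h4 := Finset.card_filter_add_card_filter_not (s := (Finset.univ : Finset α))
      (fun i => (n : ℕ∞) < c i)
    rw [Finset.card_univ] at h4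
    omega
  calc ((Fintype.card α * S.card : ℕ) : ℕ∞)
      ≤ ((2 * ∑ i, ((Finset.range S.card).filter fun n : ℕ => (n : ℕ∞) < c i).card : ℕ) : ℕ∞) :=
        Nat.cast_le.2 ((mul_le_two_mul_sum_range_sub (Finset.card_le_univ S)).trans
          (Nat.mul_le_mul_left 2 h2))
    _ ≤ 2 * ∑ i, c i := by
        push_cast
        gcongr with i
        exact h1 i

end Needle

/-! ### Measurability in the seed -/

section Measurability

variable {d : ℕ} {Ω : Type*} [MeasurableSpace Ω] (A : Algorithm d Ω) {k : ℕ}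
  (Φ : Fin (k + 1) → EuclideanSpace ℝ (Fin d)) (r : Fin (k + 1) → ℝ)

/-- The predicate may depend on the seed, so that the induction can absorb the next move into it. -/
lemma Algorithm.measurableSet_history (t : ℕ) (P : Ω → List (Fin (k + 1) × ℝ) → Prop)
    (hP : ∀ h, MeasurableSet {ω | P ω h}) :
    MeasurableSet {ω | P ω (history (A.step k Φ ω) r t)} := by
  induction t generalizing P with
  | zero => exact hP []
  | succ t ih =>
    have key : {ω | P ω (history (A.step k Φ ω) r (t + 1))} =
        {ω | (fun ω h => (∃ a, A.step k Φ ω h = Move.query a ∧ P ω ((a, r a) :: h)) ∨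
          ∃ a, A.step k Φ ω h = Move.halt a ∧ P ω h) ω (history (A.step k Φ ω) r t)} := by
      ext ω
      simp only [Set.mem_ofPred_eq]
      rcases hp : A.step k Φ ω (history (A.step k Φ ω) r t) with a | a
      · simp [history_succ_of_query _ r hp]
      · simp [history_succ_of_halt _ r hp]
    rw [key]
    refine ih (fun ω h => (∃ a, A.step k Φ ω h = Move.query a ∧ P ω ((a, r a) :: h)) ∨
      ∃ a, A.step k Φ ω h = Move.halt a ∧ P ω h) fun h => ?_
    simp only [Set.ofPred_or, Set.ofPred_exists, Set.ofPred_and]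
    exact (MeasurableSet.iUnion fun a => (A.measurable_step k Φ h _).inter (hP _)).union
      (MeasurableSet.iUnion fun a => (A.measurable_step k Φ h _).inter (hP _))

lemma Algorithm.measurableSet_returns (a : Fin (k + 1)) :
    MeasurableSet {ω | Returns (A.step k Φ ω) r a} := by
  simp only [Returns, Set.ofPred_exists]
  exact MeasurableSet.iUnion fun t => A.measurableSet_history Φ r t
    (fun ω h => A.step k Φ ω h = Move.halt a) fun h => A.measurable_step k Φ h _

lemma Algorithm.measurable_numQueries :
    Measurable fun ω => ((numQueries (A.step k Φ ω) r : ℕ∞) : ℝ≥0∞) := by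
  simp only [numQueries, ENat.toENNReal_iSup]
  exact Measurable.iSup fun t B hB => A.measurableSet_history Φ r t
    (fun _ h => ((h.length : ℕ∞) : ℝ≥0∞) ∈ B) fun h => MeasurableSet.const _

end Measurability

/-! ### Averaging over the seed -/

section LowerBounds

variable {d : ℕ} {Ω : Type*} [MeasurableSpace Ω] (A : Algorithm d Ω) {k : ℕ}
  (Φ : Fin (k + 1) → EuclideanSpace ℝ (Fin d)) (μ : Measure Ω) [IsProbabilityMeasure μ]

/-- If for each action `i` the algorithm returns `i` with probability at least `q` when the
rewards differ from `r₀` exactly at `i`, then for one of these it makes many queries. -/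
lemma Algorithm.exists_card_mul_le_two_mul_queries (q : ℝ≥0∞) (r₀ : Fin (k + 1) → ℝ)
    (r : Fin (k + 1) → Fin (k + 1) → ℝ) (hr : ∀ i a, a ≠ i → r i a = r₀ a)
    (hq : ∀ i, q ≤ μ {ω | Returns (A.step k Φ ω) (r i) i}) :
    ∃ i, ((k + 1 : ℕ) : ℝ≥0∞) * q ≤
      2 * (∫⁻ ω, ((numQueries (A.step k Φ ω) (r i) : ℕ∞) : ℝ≥0∞) ∂μ + 1) := by
  classical
  -- All the rewards `r i` are run with the same seed, and `S` is the set of needles found with that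
  -- seed.
  have hpt : ∀ ω, ((k + 1 : ℕ) : ℝ≥0∞) *
      ∑ i, {ω | Returns (A.step k Φ ω) (r i) i}.indicator (fun _ => (1 : ℝ≥0∞)) ω ≤
      2 * ∑ i, (((numQueries (A.step k Φ ω) (r i) : ℕ∞) : ℝ≥0∞) + 1) := by
    intro ω
    have h := card_mul_card_le_two_mul_sum_numQueries (A.step k Φ ω) r₀ r hr
      (Finset.univ.filter fun i => Returns (A.step k Φ ω) (r i) i)
      (fun i hi => (Finset.mem_filter.1 hi).2)
    have h' := ENat.toENNReal_mono h
    have hsum : ∀ f : Fin (k + 1) → ℕ∞, ((∑ i, f i : ℕ∞) : ℝ≥0∞) = ∑ i, (f i : ℝ≥0∞) :=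
      fun f => map_sum ENat.toENNRealRingHom f Finset.univ
    rw [ENat.toENNReal_mul, hsum] at h'
    simp only [Set.indicator_apply, Set.mem_ofPred_eq, Finset.sum_boole]
    simpa using h'
  have hint := lintegral_mono (μ := μ) hpt
  have hmeas : ∀ i, Measurable fun ω =>
      ((numQueries (A.step k Φ ω) (r i) : ℕ∞) : ℝ≥0∞) + 1 :=
    fun i => (A.measurable_numQueries Φ (r i)).add measurable_const
  rw [lintegral_const_mul _ (Finset.measurable_fun_sum _ fun i _ =>
      measurable_const.indicator (A.measurableSet_returns Φ (r i) i)),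
    lintegral_const_mul _ (Finset.measurable_fun_sum _ fun i _ => hmeas i),
    lintegral_finsetSum _ (fun i _ =>
      measurable_const.indicator (A.measurableSet_returns Φ (r i) i)),
    lintegral_finsetSum _ (fun i _ => hmeas i),
    Finset.mul_sum, Finset.mul_sum] at hint
  obtain ⟨i, -, hi⟩ := ENNReal.exists_le_of_sum_le Finset.univ_nonempty hint
  refine ⟨i, ?_⟩
  rw [lintegral_indicator_const (A.measurableSet_returns Φ (r i) i), one_mul,
    lintegral_add_right _ measurable_const, lintegral_const, measure_univ, one_mul] at hi
  exact (mul_le_mul_right (hq i) _).trans hi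

/-- If no action is acceptable for both of two reward functions, a reliable algorithm makes a query
with high probability. -/
lemma Algorithm.two_mul_le_queries_add_one (q : ℝ≥0∞) (r₁ r₂ : Fin (k + 1) → ℝ)
    (G₁ G₂ : Fin (k + 1) → Prop) (hG : ∀ a, G₁ a → ¬ G₂ a)
    (h₁ : q ≤ μ {ω | ∃ a, Returns (A.step k Φ ω) r₁ a ∧ G₁ a})
    (h₂ : q ≤ μ {ω | ∃ a, Returns (A.step k Φ ω) r₂ a ∧ G₂ a}) :
    2 * q ≤ ∫⁻ ω, ((numQueries (A.step k Φ ω) r₁ : ℕ∞) : ℝ≥0∞) ∂μ + 1 := by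
  have hm : ∀ (r : Fin (k + 1) → ℝ) (G : Fin (k + 1) → Prop),
      MeasurableSet {ω | ∃ a, Returns (A.step k Φ ω) r a ∧ G a} := by
    intro r G
    simp only [Set.ofPred_exists, Set.ofPred_and]
    exact MeasurableSet.iUnion fun a => (A.measurableSet_returns Φ r a).inter (MeasurableSet.const _)
  have hpt : ∀ ω, {ω | ∃ a, Returns (A.step k Φ ω) r₁ a ∧ G₁ a}.indicator
      (fun _ => (1 : ℝ≥0∞)) ω + {ω | ∃ a, Returns (A.step k Φ ω) r₂ a ∧ G₂ a}.indicator
      (fun _ => (1 : ℝ≥0∞)) ω ≤ ((numQueries (A.step k Φ ω) r₁ : ℕ∞) : ℝ≥0∞) + 1 := by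
    intro ω
    -- A first query makes the right side at least 2. An immediate halt returns the same action for
    -- both rewards, so at most one indicator is 1.
    rcases hp : A.step k Φ ω [] with a | a
    · have h := length_history_le_numQueries (A.step k Φ ω) r₁ 1
      rw [history_succ_of_query (A.step k Φ ω) r₁ (t := 0) hp] at h
      have h' : (1 : ℝ≥0∞) ≤ ((numQueries (A.step k Φ ω) r₁ : ℕ∞) : ℝ≥0∞) := by
        simpa [history] using ENat.toENNReal_mono h
      exact add_le_add ((Set.indicator_le_self' (by simp) ω).trans h')
        (Set.indicator_le_self' (by simp) ω)
    · refine le_add_left ?_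
      by_cases ha : G₁ a
      · rw [Set.indicator_of_notMem (s := {ω | ∃ a, Returns (A.step k Φ ω) r₂ a ∧ G₂ a}), add_zero]
        · exact Set.indicator_le_self' (by simp) ω
        · rintro ⟨b, hb, hb'⟩
          rw [hb.eq_of_halt (t := 0) hp] at hb'
          exact hG a ha hb'
      · rw [Set.indicator_of_notMem (s := {ω | ∃ a, Returns (A.step k Φ ω) r₁ a ∧ G₁ a}), zero_add]
        · exact Set.indicator_le_self' (by simp) ω
        · rintro ⟨b, hb, hb'⟩
          rw [hb.eq_of_halt (t := 0) hp] at hb'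
          exact ha hb'
  have hint := lintegral_mono (μ := μ) hpt
  rw [lintegral_add_left (measurable_const.indicator (hm r₁ G₁)),
    lintegral_indicator_const (hm r₁ G₁), lintegral_indicator_const (hm r₂ G₂),
    lintegral_add_right _ measurable_const, lintegral_const, measure_univ, one_mul, one_mul,
    one_mul] at hint
  rw [two_mul]
  exact (add_le_add h₁ h₂).trans hint

end LowerBounds

/-! ### Incoherent words by Chernoff and greedy packing -/

section Packing

/-- Greedy packing: if every point conflicts with at most `D` points, there are at least `|W| / D`
points without conflicts. -/
lemma exists_finset_pairwise_not_card_le {W : Type*} [Fintype W] (B : W → W → Prop)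
    [DecidableRel B] (hrefl : ∀ w, B w w) (hsymm : ∀ w w', B w w' → B w' w) (D : ℝ)
    (hD : ∀ w, ((Finset.univ.filter fun w' => B w w').card : ℝ) ≤ D) :
    ∃ S : Finset W, (S : Set W).Pairwise (fun w w' => ¬ B w w') ∧
      (Fintype.card W : ℝ) ≤ S.card * D := by
  classical
  obtain ⟨S, hS, hmax⟩ := Finset.exists_max_image
    (Finset.univ.filter fun S : Finset W => (S : Set W).Pairwise (fun w w' => ¬ B w w'))
    Finset.card ⟨∅, by simp⟩
  refine ⟨S, (Finset.mem_filter.1 hS).2, ?_⟩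
  have hcover : (Finset.univ : Finset W) ⊆
      S.biUnion fun w => Finset.univ.filter fun w' => B w w' := by
    intro x _
    by_contra hx
    simp only [Finset.mem_biUnion, Finset.mem_filter, Finset.mem_univ, true_and, not_exists,
      not_and] at hx
    have hxS : x ∉ S := fun h => hx x h (hrefl x)
    have hins : ((insert x S : Finset W) : Set W).Pairwise (fun w w' => ¬ B w w') := by
      rw [Finset.coe_insert]
      exact (Finset.mem_filter.1 hS).2.insert fun w hw _ =>
        ⟨fun h => hx w hw (hsymm _ _ h), hx w hw⟩
    have := hmax (insert x S) (Finset.mem_filter.2 ⟨Finset.mem_univ _, hins⟩)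
    rw [Finset.card_insert_of_notMem hxS] at this
    omega
  calc (Fintype.card W : ℝ)
      ≤ ((S.biUnion fun w => Finset.univ.filter fun w' => B w w').card : ℝ) := by
        exact_mod_cast Finset.card_le_card hcover
    _ ≤ ∑ w ∈ S, ((Finset.univ.filter fun w' => B w w').card : ℝ) := by
        exact_mod_cast Finset.card_biUnion_le
    _ ≤ S.card * D := by
        rw [← nsmul_eq_mul]
        exact Finset.sum_le_card_nsmul _ _ _ fun w _ => hD w

/-- The sign encoded by a Boolean. -/
def sign (c : Bool) : ℝ := if c then 1 else -1

lemma sign_mul_self (c : Bool) : sign c * sign c = 1 := by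
  cases c <;> simp [sign]

lemma sign_ne_zero (c : Bool) : sign c ≠ 0 := by
  cases c <;> simp [sign]

/-- The inner product of two signed basis vectors of `ℝ ^ b`. -/
def letterInner {b : ℕ} (x y : Fin b × Bool) : ℝ :=
  if x.1 = y.1 then sign x.2 * sign y.2 else 0

/-- The inner product of two vectors made of `s` blocks, each of them a signed basis vector. -/
def wordInner {s b : ℕ} (w w' : Fin s → Fin b × Bool) : ℝ :=
  ∑ i, letterInner (w i) (w' i)

lemma wordInner_self {s b : ℕ} (w : Fin s → Fin b × Bool) : wordInner w w = s := by
  simp [wordInner, letterInner, sign_mul_self]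

lemma wordInner_comm {s b : ℕ} (w w' : Fin s → Fin b × Bool) :
    wordInner w w' = wordInner w' w := by
  simp only [wordInner, letterInner, mul_comm, eq_comm]

/-- Only the two letters at the position of `x` have nonzero inner product, `1` and `-1`; each other
letter contributes 1. -/
lemma sum_exp_letterInner {b : ℕ} (x : Fin b × Bool) (t : ℝ) :
    ∑ y, Real.exp (t * letterInner x y) = 2 * b + 2 * (Real.cosh t - 1) := by
  obtain ⟨x, c⟩ := x
  have h : ∀ y : Fin b, ∑ e : Bool, Real.exp (t * letterInner (x, c) (y, e)) =
      2 + if x = y then 2 * (Real.cosh t - 1) else 0 := by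
    intro y
    rw [Fintype.sum_bool]
    by_cases hxy : x = y
    · cases c <;> simp [letterInner, hxy, sign, Real.cosh_eq] <;> ring
    · simp [letterInner, hxy]
      norm_num
  rw [Fintype.sum_prod_type]
  simp_rw [h]
  simp [Finset.sum_add_distrib]
  ring

/-- The blocks of a uniform word are independent, so the moment generating function factors; each
factor is bounded through `cosh t - 1 ≤ t ^ 2` and `1 + x ≤ exp x`. -/
lemma sum_exp_wordInner_le {s b : ℕ} (hb : 0 < b) (w : Fin s → Fin b × Bool) {t : ℝ}
    (ht : |t| ≤ 1) :
    ∑ w', Real.exp (t * wordInner w w') ≤ (2 * b : ℝ) ^ s * Real.exp (s * t ^ 2 / b) := by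
  have hb' : (0 : ℝ) < b := by exact_mod_cast hb
  have h1 : ∑ w', Real.exp (t * wordInner w w') =
      ∏ i : Fin s, ∑ y, Real.exp (t * letterInner (w i) y) := by
    rw [Finset.prod_univ_sum, Fintype.piFinset_univ]
    refine Finset.sum_congr rfl fun w' _ => ?_
    rw [wordInner, Finset.mul_sum, Real.exp_sum]
  have ht2 : t ^ 2 ≤ 1 := by
    rw [← sq_abs]
    exact pow_le_one₀ (abs_nonneg t) ht
  have hcosh : Real.cosh t - 1 ≤ t ^ 2 := by
    have h2 := Real.cosh_le_exp_half_sq t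
    have h3 : |Real.exp (t ^ 2 / 2) - 1| ≤ 2 * |t ^ 2 / 2| :=
      Real.abs_exp_sub_one_le (by rw [abs_of_nonneg (by positivity)]; linarith)
    rw [abs_of_nonneg (show (0 : ℝ) ≤ t ^ 2 / 2 by positivity)] at h3
    linarith [le_abs_self (Real.exp (t ^ 2 / 2) - 1)]
  have h4 : 2 * b + 2 * (Real.cosh t - 1) ≤ 2 * b * Real.exp (t ^ 2 / b) := by
    have h5 := Real.add_one_le_exp (t ^ 2 / b)
    calc 2 * (b : ℝ) + 2 * (Real.cosh t - 1) ≤ 2 * b * (t ^ 2 / b + 1) := by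
          field_simp
          linarith
      _ ≤ _ := by gcongr
  rw [h1]
  simp_rw [sum_exp_letterInner]
  rw [Finset.prod_const, Finset.card_univ, Fintype.card_fin]
  have h0 : 0 ≤ 2 * b + 2 * (Real.cosh t - 1) := by
    have := Real.one_le_cosh t
    linarith
  calc _ ≤ (2 * b * Real.exp (t ^ 2 / b)) ^ s := pow_le_pow_left₀ h0 h4 s
    _ = _ := by
      rw [mul_pow, ← Real.exp_nat_mul]
      ring_nf

lemma card_le_abs_wordInner_le {s b : ℕ} (hb : 0 < b) (w : Fin s → Fin b × Bool) {t τ : ℝ}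
    (ht0 : 0 ≤ t) (ht : t ≤ 1) :
    ((Finset.univ.filter fun w' => τ * s ≤ |wordInner w w'|).card : ℝ) ≤
      (2 * b : ℝ) ^ s * (2 * Real.exp (-(t * τ * s - s * t ^ 2 / b))) := by
  -- Exponential Markov inequality for both tails at once.
  have h1 : ∀ w', (if τ * s ≤ |wordInner w w'| then (1 : ℝ) else 0) ≤ Real.exp (-(t * τ * s)) *
      (Real.exp (t * wordInner w w') + Real.exp (-t * wordInner w w')) := by
    intro w'
    split_ifs with h
    · rw [mul_add, ← Real.exp_add, ← Real.exp_add]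
      have h2 := mul_le_mul_of_nonneg_left h ht0
      rcases abs_cases (wordInner w w') with ⟨h3, -⟩ | ⟨h3, -⟩
      · rw [h3] at h2
        have := Real.one_le_exp (x := -(t * τ * s) + t * wordInner w w') (by linarith)
        linarith [Real.exp_pos (-(t * τ * s) + -t * wordInner w w')]
      · rw [h3] at h2
        have := Real.one_le_exp (x := -(t * τ * s) + -t * wordInner w w') (by linarith)
        linarith [Real.exp_pos (-(t * τ * s) + t * wordInner w w')]
    · positivity
  have h2 := sum_exp_wordInner_le hb w (t := t) (by rwa [abs_of_nonneg ht0])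
  have h3 := sum_exp_wordInner_le hb w (t := -t) (by rwa [abs_neg, abs_of_nonneg ht0])
  rw [neg_sq] at h3
  have h4 : ((Finset.univ.filter fun w' => τ * s ≤ |wordInner w w'|).card : ℝ) =
      ∑ w', if τ * s ≤ |wordInner w w'| then (1 : ℝ) else 0 := by
    rw [Finset.sum_boole]
  rw [h4]
  refine (Finset.sum_le_sum fun w' _ => h1 w').trans ?_
  rw [← Finset.mul_sum, Finset.sum_add_distrib]
  calc _ ≤ Real.exp (-(t * τ * s)) * ((2 * b : ℝ) ^ s * Real.exp (s * t ^ 2 / b) +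
        (2 * b : ℝ) ^ s * Real.exp (s * t ^ 2 / b)) := by gcongr
    _ = _ := by
      rw [show -(t * τ * s - s * t ^ 2 / b) = -(t * τ * s) + s * t ^ 2 / b by ring, Real.exp_add]
      ring

/-- Words of length `s` over the signed basis vectors of `ℝ ^ b` with small inner products. -/
lemma exists_incoherent_words {s b : ℕ} (hb : 0 < b) {τ : ℝ} (hτ0 : 0 < τ) (hτ : τ ≤ 1) :
    ∃ S : Finset (Fin s → Fin b × Bool),
      (S : Set (Fin s → Fin b × Bool)).Pairwise (fun w w' => |wordInner w w'| < τ * s) ∧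
      Real.exp (min (s * b * τ ^ 2 / 4) (s * τ / 2)) / 2 ≤ S.card := by
  classical
  have hb' : (0 : ℝ) < b := by exact_mod_cast hb
  set E := min (s * b * τ ^ 2 / 4) (s * τ / 2) with hE
  -- The exponent is largest at `t = τ b / 2`. If that exceeds 1, `t = 1` is used, and `1 / b ≤ τ /
  -- 2` leaves at least half of `s τ`.
  obtain ⟨t, ht0, ht1, hEt⟩ : ∃ t : ℝ, 0 ≤ t ∧ t ≤ 1 ∧ E ≤ t * τ * s - s * t ^ 2 / b := by
    rcases le_total (τ * b / 2) 1 with h | h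
    · refine ⟨τ * b / 2, by positivity, h, (min_le_left _ _).trans (le_of_eq ?_)⟩
      field_simp
      ring
    · refine ⟨1, zero_le_one, le_rfl, (min_le_right _ _).trans ?_⟩
      have h2 : (s : ℝ) * 1 ^ 2 / b ≤ s * τ / 2 := by
        rw [div_le_div_iff₀ hb' two_pos]
        have := mul_le_mul_of_nonneg_left h (Nat.cast_nonneg (α := ℝ) s)
        linarith
      linarith
  obtain ⟨S, hS, hcard⟩ := exists_finset_pairwise_not_card_le
    (fun w w' : Fin s → Fin b × Bool => τ * s ≤ |wordInner w w'|)
    (fun w => by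
      rw [wordInner_self, abs_of_nonneg (Nat.cast_nonneg s)]
      exact mul_le_of_le_one_left (Nat.cast_nonneg s) hτ)
    (fun w w' h => by rwa [wordInner_comm]) ((2 * b : ℝ) ^ s * (2 * Real.exp (-E)))
    (fun w => (card_le_abs_wordInner_le hb w ht0 ht1).trans (by gcongr))
  refine ⟨S, fun w hw w' hw' hne => not_le.1 (hS hw hw' hne), ?_⟩
  simp only [Fintype.card_pi, Fintype.card_prod, Fintype.card_fin, Fintype.card_bool,
    Finset.prod_const, Finset.card_univ] at hcard
  push_cast at hcard
  have hpos : (0 : ℝ) < (2 * b) ^ s := by positivity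
  rw [mul_comm (b : ℝ) 2, mul_left_comm] at hcard
  have h1 : 1 ≤ S.card * (2 * Real.exp (-E)) := by
    by_contra! h
    have := mul_lt_mul_of_pos_left h hpos
    linarith
  rw [Real.exp_neg] at h1
  have := Real.exp_pos E
  field_simp at h1
  linarith

end Packing

/-! ### Words as sparse unit vectors -/

section WordVectors

variable {d s b : ℕ}

/-- The unit vector whose only nonzero entries are `± 1 / √s`, one in each of `s` blocks of
coordinates, at the position and with the sign given by the word `w`. -/
noncomputable def wordVec (ι : Fin s × Fin b → Fin d) (w : Fin s → Fin b × Bool) :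
    EuclideanSpace ℝ (Fin d) :=
  (√s)⁻¹ • ∑ i, EuclideanSpace.single (ι (i, (w i).1)) (sign (w i).2)

variable {ι : Fin s × Fin b → Fin d} (hι : Function.Injective ι)
include hι

lemma inner_wordVec (hs : 0 < s) (w w' : Fin s → Fin b × Bool) :
    inner ℝ (wordVec ι w) (wordVec ι w') = wordInner w w' / s := by
  have hs' : (0 : ℝ) < s := by exact_mod_cast hs
  have h : ∀ i j, inner ℝ (EuclideanSpace.single (ι (i, (w i).1)) (sign (w i).2))
      (EuclideanSpace.single (ι (j, (w' j).1)) (sign (w' j).2)) =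
      if i = j then letterInner (w i) (w' j) else 0 := by
    intro i j
    rw [EuclideanSpace.inner_single_left]
    by_cases hij : i = j
    · subst hij
      by_cases hw : (w i).1 = (w' i).1
      · simp [letterInner, hw]
      · have : ι (i, (w i).1) ≠ ι (i, (w' i).1) := fun h => hw (by simpa using hι h)
        simp [letterInner, hw, this]
    · have : ι (i, (w i).1) ≠ ι (j, (w' j).1) := fun h => hij (by simpa using congrArg Prod.fst (hι h))
      simp [hij, this]
  rw [wordVec, wordVec, real_inner_smul_left, real_inner_smul_right, sum_inner]
  simp_rw [inner_sum, h]
  simp only [Finset.sum_ite_eq, Finset.mem_univ, if_true]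
  rw [← wordInner, ← mul_assoc, ← mul_inv, Real.mul_self_sqrt hs'.le]
  ring

lemma norm_wordVec (hs : 0 < s) (w : Fin s → Fin b × Bool) : ‖wordVec ι w‖ = 1 := by
  have hs' : (s : ℝ) ≠ 0 := by exact_mod_cast hs.ne'
  have h := inner_wordVec hι hs w w
  rw [wordInner_self, div_self hs', real_inner_self_eq_norm_sq] at h
  exact (pow_eq_one_iff_of_nonneg (norm_nonneg _) two_ne_zero).1 h

lemma card_support_wordVec (hs : 0 < s) (w : Fin s → Fin b × Bool) :
    (Finset.univ.filter fun j => wordVec ι w j ≠ 0).card = s := by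
  classical
  have hinj : Function.Injective fun i => ι (i, (w i).1) := fun i j h => by
    simpa using congrArg Prod.fst (hι h)
  have hs' : (√s)⁻¹ ≠ 0 := by
    have : (0 : ℝ) < s := by exact_mod_cast hs
    positivity
  have hval : ∀ j, wordVec ι w j =
      (√s)⁻¹ * ∑ i, if j = ι (i, (w i).1) then sign (w i).2 else 0 := by
    intro j
    simp [wordVec, Pi.single_apply]
  have himg : (Finset.univ.filter fun j => wordVec ι w j ≠ 0) =
      Finset.univ.image fun i => ι (i, (w i).1) := by
    ext j
    simp only [Finset.mem_filter, Finset.mem_univ, true_and, Finset.mem_image]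
    constructor
    · intro h
      by_contra! hne
      refine h ?_
      rw [hval, Finset.sum_eq_zero fun i _ => if_neg (hne i).symm, mul_zero]
    · rintro ⟨i, rfl⟩
      rw [hval, Finset.sum_eq_single i (fun i' _ hi' => if_neg fun h => hi' (hinj h).symm)
        (by simp), if_pos rfl]
      exact mul_ne_zero hs' (sign_ne_zero _)
  rw [himg, Finset.card_image_of_injective _ hinj, Finset.card_univ, Fintype.card_fin]

end WordVectors

/-- Many unit vectors with exactly `s` nonzero entries and small inner products. -/
lemma exists_incoherent_sparse_vectors {d s : ℕ} (hs : 1 ≤ s) (hsd : s ≤ d) {τ : ℝ} (hτ0 : 0 < τ)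
    (hτ : τ ≤ 1) :
    ∃ (k : ℕ) (v : Fin (k + 1) → EuclideanSpace ℝ (Fin d)), (∀ i, ‖v i‖ = 1) ∧
      (∀ i, (Finset.univ.filter fun j => v i j ≠ 0).card = s) ∧
      (∀ i j, i ≠ j → |inner ℝ (v i) (v j)| < τ) ∧
      Real.exp (min (d * τ ^ 2 / 8) (s * τ / 2)) / 2 ≤ (k + 1 : ℕ) := by
  set b := d / s with hb
  have hb0 : 0 < b := Nat.div_pos hsd hs
  have hle : s * b ≤ d := Nat.mul_div_le d s
  -- Rounding `d / s` down loses at most a factor 2, whence `8` in place of `4` in the exponent.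
  have hdle : d ≤ 2 * (s * b) := by
    have h1 := Nat.lt_mul_div_succ d hs
    rw [← hb, Nat.mul_succ] at h1
    have h2 := Nat.mul_le_mul_left s hb0
    omega
  have hs' : (0 : ℝ) < s := by exact_mod_cast hs
  let ι : Fin s × Fin b → Fin d := fun x => Fin.castLE hle (finProdFinEquiv x)
  have hι : Function.Injective ι := (Fin.castLE_injective hle).comp finProdFinEquiv.injective
  obtain ⟨S, hS, hcard⟩ := exists_incoherent_words (s := s) hb0 hτ0 hτ
  have hpos : 0 < S.card := by
    have := (by positivity : 0 < Real.exp (min (s * b * τ ^ 2 / 4) (s * τ / 2)) / 2).trans_le hcard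
    exact_mod_cast this
  obtain ⟨k, hk⟩ := Nat.exists_eq_succ_of_ne_zero hpos.ne'
  let e : Fin (k + 1) ≃ S := (S.equivFinOfCardEq hk).symm
  refine ⟨k, fun i => wordVec ι (e i), fun i => norm_wordVec hι hs _,
    fun i => card_support_wordVec hι hs _, fun i j hij => ?_, ?_⟩
  · rw [inner_wordVec hι hs, abs_div, abs_of_pos hs', div_lt_iff₀ hs']
    exact hS (e i).2 (e j).2 fun h => hij (e.injective (Subtype.ext h))
  · rw [hk] at hcard
    refine le_trans ?_ hcard
    have h : (d : ℝ) ≤ 2 * (s * b) := by exact_mod_cast hdle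
    gcongr ?_ / 2
    refine Real.exp_le_exp.2 (min_le_min ?_ le_rfl)
    nlinarith [sq_nonneg τ]

/-! ### The hard instances -/

section Instances

variable {d s : ℕ} {ε Δ R : ℝ}

lemma card_support_smul (c : ℝ) (hc : c ≠ 0) (v : EuclideanSpace ℝ (Fin d)) :
    (Finset.univ.filter fun j => (c • v) j ≠ 0).card =
      (Finset.univ.filter fun j => v j ≠ 0).card := by
  simp [hc]

/-- The instance whose only action with nonzero reward is `i`, with reward `Δ + ε`. -/
noncomputable def needleInstance (hε : 0 < ε) (hεΔ : ε ≤ Δ) (hΔR : Δ ≤ R) {k : ℕ}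
    (v : Fin (k + 1) → EuclideanSpace ℝ (Fin d)) (hv : ∀ i, ‖v i‖ = 1)
    (hsupp : ∀ i, (Finset.univ.filter fun j => v i j ≠ 0).card = s)
    (hinner : ∀ i j, i ≠ j → |inner ℝ (v i) (v j)| < ε / Δ) (i : Fin (k + 1)) :
    Instance d s ε R where
  k := k
  Φ := v
  Φ_injective := fun a b hab => by
    by_contra hne
    have h := hinner a b hne
    rw [hab, real_inner_self_eq_norm_sq, hv, one_pow, abs_one] at h
    exact absurd h (not_lt.2 ((div_le_one (hε.trans_le hεΔ)).2 hεΔ))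
  Φ_norm_le := fun a => (hv a).le
  θ := Δ • v i
  θ_sparse := by rw [card_support_smul Δ (hε.trans_le hεΔ).ne', hsupp]
  θ_norm_le := by
    rw [norm_smul, hv, mul_one, Real.norm_of_nonneg (hε.trans_le hεΔ).le]
    exact hΔR
  ν := fun a => if a = i then ε else -(Δ * inner ℝ (v a) (v i))
  ν_le := fun a => by
    split_ifs with h
    · rw [abs_of_pos hε]
    · have hΔ := hε.trans_le hεΔ
      rw [abs_neg, abs_mul, abs_of_pos hΔ, mul_comm, ← le_div_iff₀ hΔ]
      exact (hinner a i h).le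

lemma needleInstance_reward (hε : 0 < ε) (hεΔ : ε ≤ Δ) (hΔR : Δ ≤ R) {k : ℕ}
    (v : Fin (k + 1) → EuclideanSpace ℝ (Fin d)) (hv : ∀ i, ‖v i‖ = 1)
    (hsupp : ∀ i, (Finset.univ.filter fun j => v i j ≠ 0).card = s)
    (hinner : ∀ i j, i ≠ j → |inner ℝ (v i) (v j)| < ε / Δ) (i : Fin (k + 1)) :
    (needleInstance hε hεΔ hΔR v hv hsupp hinner i).reward =
      fun a : Fin (k + 1) => if a = i then Δ + ε else 0 := by
  funext (a : Fin (k + 1))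
  change inner ℝ (v a) (Δ • v i) + (if a = i then ε else -(Δ * inner ℝ (v a) (v i))) = _
  rw [real_inner_smul_right]
  split_ifs with h
  · rw [h, real_inner_self_eq_norm_sq, hv]
    ring
  · ring

/-- The two actions `u` and `-u` with parameter `Δ c u` and no misspecification. -/
noncomputable def antipodalInstance (hε : 0 < ε) (hεΔ : ε ≤ Δ) (hΔR : Δ ≤ R)
    (u : EuclideanSpace ℝ (Fin d)) (hu : ‖u‖ = 1)
    (hsupp : (Finset.univ.filter fun j => u j ≠ 0).card = s) (c : Bool) : Instance d s ε R where
  k := 1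
  Φ := ![u, -u]
  Φ_injective := by
    have hne : u ≠ -u := fun h => by
      have h2 : (2 : ℝ) • u = 0 := by
        rw [two_smul]
        exact add_eq_zero_iff_eq_neg.2 h
      have h3 := congrArg norm h2
      rw [norm_smul, hu] at h3
      norm_num at h3
    intro a b
    fin_cases a <;> fin_cases b <;> simp [hne, hne.symm]
  Φ_norm_le := fun a => by fin_cases a <;> simp [hu]
  θ := (Δ * sign c) • u
  θ_sparse := by rw [card_support_smul _ (mul_ne_zero (hε.trans_le hεΔ).ne' (sign_ne_zero c)), hsupp]
  θ_norm_le := by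
    have hΔ := hε.trans_le hεΔ
    cases c <;> simpa [norm_smul, hu, sign, abs_of_pos hΔ] using hΔR
  ν := 0
  ν_le := fun a => by simpa using hε.le

lemma antipodalInstance_reward (hε : 0 < ε) (hεΔ : ε ≤ Δ) (hΔR : Δ ≤ R)
    (u : EuclideanSpace ℝ (Fin d)) (hu : ‖u‖ = 1)
    (hsupp : (Finset.univ.filter fun j => u j ≠ 0).card = s) (c : Bool) :
    (antipodalInstance hε hεΔ hΔR u hu hsupp c).reward =
      (![Δ * sign c, -(Δ * sign c)] : Fin 2 → ℝ) := by
  funext (a : Fin 2)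
  change inner ℝ ((![u, -u] : Fin 2 → EuclideanSpace ℝ (Fin d)) a) ((Δ * sign c) • u) + 0 = _
  rw [real_inner_smul_right]
  fin_cases a <;> simp [hu]

end Instances

/-! ### Lower bounds for sound algorithms -/

section Soundness

variable {d s : ℕ} {ε Δ R η : ℝ} {Ω : Type*} [MeasurableSpace Ω] {μ : Measure Ω}
  {A : Algorithm d Ω}

lemma Algorithm.Sound.le_measure (hA : A.Sound μ s ε R η Δ) (I : Instance d s ε R)
    {r : Fin (I.k + 1) → ℝ} (hr : I.reward = r) :
    ENNReal.ofReal (1 - η) ≤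
      μ {ω | ∃ a, Returns (A.step I.k I.Φ ω) r a ∧ ∀ x, r x - Δ ≤ r a} :=
  hr ▸ hA I

lemma Algorithm.expectedQueries_eq (I : Instance d s ε R) {r : Fin (I.k + 1) → ℝ}
    (hr : I.reward = r) : A.expectedQueries μ I =
      ∫⁻ ω, ((numQueries (A.step I.k I.Φ ω) r : ℕ∞) : ℝ≥0∞) ∂μ :=
  hr ▸ rfl

lemma Algorithm.Sound.exists_two_mul_le [IsProbabilityMeasure μ] (hA : A.Sound μ s ε R η Δ)
    (hs : 1 ≤ s) (hsd : s ≤ d) (hε : 0 < ε) (hεΔ : ε ≤ Δ) (hΔR : Δ ≤ R) :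
    ∃ I : Instance d s ε R, 2 * ENNReal.ofReal (1 - η) ≤ A.expectedQueries μ I + 1 := by
  have hΔ := hε.trans_le hεΔ
  -- Only one `s`-sparse unit vector is needed; the threshold 1 is arbitrary.
  obtain ⟨k, v, hv, hsupp, -, -⟩ := exists_incoherent_sparse_vectors hs hsd one_pos le_rfl
  let J := antipodalInstance hε hεΔ hΔR (v 0) (hv 0) (hsupp 0)
  let r : Bool → Fin 2 → ℝ := fun c => ![Δ * sign c, -(Δ * sign c)]
  have hr : ∀ c, (J c).reward = r c :=
    antipodalInstance_reward hε hεΔ hΔR (v 0) (hv 0) (hsupp 0)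
  refine ⟨J true, ?_⟩
  rw [A.expectedQueries_eq _ (hr true)]
  refine A.two_mul_le_queries_add_one (k := 1) ![v 0, -v 0] μ _ (r true) (r false)
    (fun a => ∀ x, r true x - Δ ≤ r true a) (fun a => ∀ x, r false x - Δ ≤ r false a)
    (fun a h₁ h₂ => ?_) (hA.le_measure (J true) (hr true)) (hA.le_measure (J false) (hr false))
  -- The two rewards are `Δ` and `-Δ`, a gap of `2 Δ`, so only the better action is acceptable.
  have h₁ := h₁ 0
  have h₂ := h₂ 1
  fin_cases a
  · simp [r, sign] at h₂
    linarith
  · simp [r, sign] at h₁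
    linarith

lemma Algorithm.Sound.exists_exp_le_two_mul [IsProbabilityMeasure μ] (hA : A.Sound μ s ε R η Δ)
    (hs : 1 ≤ s) (hsd : s ≤ d) (hε : 0 < ε) (hεΔ : ε ≤ Δ) (hΔR : Δ ≤ R) :
    ∃ I : Instance d s ε R,
      ENNReal.ofReal (Real.exp (min (d * (ε / Δ) ^ 2 / 8) (s * (ε / Δ) / 2)) / 2) *
        ENNReal.ofReal (1 - η) ≤ 2 * (A.expectedQueries μ I + 1) := by
  have hΔ := hε.trans_le hεΔ
  obtain ⟨k, v, hv, hsupp, hinner, hk⟩ := exists_incoherent_sparse_vectors hs hsd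
    (div_pos hε hΔ) ((div_le_one hΔ).2 hεΔ)
  let J := needleInstance hε hεΔ hΔR v hv hsupp hinner
  let r : Fin (k + 1) → Fin (k + 1) → ℝ := fun i a => if a = i then Δ + ε else 0
  have hr : ∀ i, (J i).reward = r i := needleInstance_reward hε hεΔ hΔR v hv hsupp hinner
  obtain ⟨i, hi⟩ := A.exists_card_mul_le_two_mul_queries v μ (ENNReal.ofReal (1 - η)) 0 r
    (fun i a h => if_neg h) (fun i => by
      refine (hA.le_measure (J i) (hr i)).trans (measure_mono ?_)
      rintro ω ⟨a, ha, hopt⟩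
      have h : r i i - Δ ≤ r i a := hopt i
      have hai : a = i := by
        by_contra hne
        rw [show r i i = Δ + ε from if_pos rfl, show r i a = 0 from if_neg hne] at h
        linarith
      rw [hai] at ha
      exact ha)
  refine ⟨J i, ?_⟩
  rw [A.expectedQueries_eq _ (hr i)]
  refine le_trans ?_ hi
  gcongr
  rw [← ENNReal.ofReal_natCast]
  exact ENNReal.ofReal_le_ofReal hk

lemma Algorithm.Sound.exists_exp_le [IsProbabilityMeasure μ] (hA : A.Sound μ s ε R η Δ)
    (hs : 1 ≤ s) (hsd : s ≤ d) (hε : 0 < ε) (hεΔ : ε ≤ Δ) (hΔR : Δ ≤ R) (hη : η < 1) :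
    ∃ I : Instance d s ε R,
      ENNReal.ofReal ((1 - η) * Real.exp (min (d * (ε / Δ) ^ 2 / 8) (s * (ε / Δ) / 2) / 3)) ≤
        A.expectedQueries μ I + 1 := by
  have hη' : 0 ≤ 1 - η := by linarith
  set E := min (d * (ε / Δ) ^ 2 / 8) (s * (ε / Δ) / 2) with hE
  have hcube : Real.exp E = Real.exp (E / 3) ^ 3 := by
    rw [← Real.exp_nat_mul]
    congr 1
    push_cast
    ring
  rcases le_total (Real.exp (E / 3)) 2 with h | h
  · obtain ⟨I, hI⟩ := hA.exists_two_mul_le hs hsd hε hεΔ hΔR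
    refine ⟨I, le_trans ?_ hI⟩
    rw [mul_comm, ENNReal.ofReal_mul (Real.exp_pos _).le]
    gcongr
    simpa using ENNReal.ofReal_le_ofReal h
  · obtain ⟨I, hI⟩ := hA.exists_exp_le_two_mul hs hsd hε hεΔ hΔR
    refine ⟨I, ?_⟩
    have h2 : 2 * ENNReal.ofReal ((1 - η) * Real.exp (E / 3)) ≤
        2 * (A.expectedQueries μ I + 1) := by
      refine le_trans ?_ hI
      rw [← ENNReal.ofReal_mul (by positivity), show (2 : ℝ≥0∞) = ENNReal.ofReal 2 by simp,
        ← ENNReal.ofReal_mul two_pos.le]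
      refine ENNReal.ofReal_le_ofReal ?_
      rw [← hE, hcube]
      have h4 : 4 ≤ Real.exp (E / 3) ^ 2 := by nlinarith
      have h5 : 4 * Real.exp (E / 3) ≤ Real.exp (E / 3) ^ 3 := by
        rw [pow_succ]
        gcongr
      nlinarith
    exact (ENNReal.mul_le_mul_iff_right two_ne_zero ENNReal.ofNat_ne_top).1 h2

end Soundness

end MisspecifiedBandit

theorem theorem2 (C' : ℝ) (hC' : 0 < C') :
    ∃ c₀ c₁ : ℝ, 0 < c₀ ∧ 0 < c₁ ∧
      ∀ (d s : ℕ) (ε Δ R η : ℝ), 1 ≤ s → s ≤ d → 0 < ε → ε ≤ Δ → Δ ≤ R → 0 < η → η < 1 →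
      ∀ (Ω : Type*) [MeasurableSpace Ω] (μ : Measure Ω) [IsProbabilityMeasure μ]
        (A : MisspecifiedBandit.Algorithm d Ω), A.Sound μ s ε R η Δ →
      ∃ I : MisspecifiedBandit.Instance d s ε R,
        (ε / Δ ≤ C' * s / d →
          ENNReal.ofReal ((1 - η) * Real.exp (c₀ * d * (ε / Δ) ^ 2))
            ≤ A.expectedQueries μ I + 1) ∧
        (C' * s / d < ε / Δ →
          ENNReal.ofReal ((1 - η) * Real.exp (c₁ * s * (ε / Δ)))
            ≤ A.expectedQueries μ I + 1) ∧
        (∀ K δ : ℝ, 0 < K → 0 < δ → δ < 1 →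
          Δ ≤ K * (s : ℝ) ^ δ * ε → C' * K * (s : ℝ) ^ (1 + δ) < d →
          ENNReal.ofReal ((1 - η) * Real.exp (c₁ / K * (s : ℝ) ^ (1 - δ)))
            ≤ A.expectedQueries μ I + 1) := by
  -- The factor `1 / 3` comes from `Algorithm.Sound.exists_exp_le`. The rest compares the two terms
  -- of the minimum: `s τ ≥ d τ² / C'` in the first regime, `d τ² > C' s τ` in the second.
  refine ⟨min (1 / 8) (1 / (2 * C')) / 3, min (C' / 8) (1 / 2) / 3, by positivity, by positivity,
    fun d s ε Δ R η hs hsd hε hεΔ hΔR _ hη Ω _ μ _ A hA => ?_⟩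
  obtain ⟨I, hI⟩ := hA.exists_exp_le hs hsd hε hεΔ hΔR hη
  have hη' : 0 ≤ 1 - η := by linarith
  have hΔ := hε.trans_le hεΔ
  have hs' : (0 : ℝ) < s := by exact_mod_cast hs
  have hd' : (0 : ℝ) < d := by exact_mod_cast hs.trans hsd
  have hτ : 0 < ε / Δ := div_pos hε hΔ
  have key : ∀ x ≤ min (d * (ε / Δ) ^ 2 / 8) (s * (ε / Δ) / 2) / 3,
      ENNReal.ofReal ((1 - η) * Real.exp x) ≤ A.expectedQueries μ I + 1 := fun x hx =>
    le_trans (ENNReal.ofReal_le_ofReal (by gcongr)) hI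
  have hlarge : C' * s / d < ε / Δ → min (C' / 8) (1 / 2) / 3 * s * (ε / Δ) ≤
      min (d * (ε / Δ) ^ 2 / 8) (s * (ε / Δ) / 2) / 3 := by
    intro h
    rw [div_lt_iff₀ hd'] at h
    rw [div_mul_eq_mul_div, div_mul_eq_mul_div]
    gcongr
    refine le_min ?_ ?_
    · calc min (C' / 8) (1 / 2) * s * (ε / Δ) ≤ C' / 8 * s * (ε / Δ) := by
            gcongr
            exact min_le_left _ _
        _ ≤ _ := by nlinarith
    · calc min (C' / 8) (1 / 2) * s * (ε / Δ) ≤ 1 / 2 * s * (ε / Δ) := by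
            gcongr
            exact min_le_right _ _
        _ = _ := by ring
  refine ⟨I, fun h => key _ ?_, fun h => key _ (hlarge h), fun K δ hK _ _ h₁ h₂ => key _ ?_⟩
  · rw [le_div_iff₀ hd'] at h
    rw [div_mul_eq_mul_div, div_mul_eq_mul_div]
    gcongr
    refine le_min ?_ ?_
    · calc min (1 / 8) (1 / (2 * C')) * d * (ε / Δ) ^ 2 ≤ 1 / 8 * d * (ε / Δ) ^ 2 := by
            gcongr
            exact min_le_left _ _
        _ = _ := by ring
    · calc min (1 / 8) (1 / (2 * C')) * d * (ε / Δ) ^ 2 ≤ 1 / (2 * C') * d * (ε / Δ) ^ 2 := by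
            gcongr
            exact min_le_right _ _
        _ = ε / Δ * d * (ε / Δ) / (2 * C') := by ring
        _ ≤ C' * s * (ε / Δ) / (2 * C') := by gcongr
        _ = _ := by field_simp
  · have hsδ : (0 : ℝ) < (s : ℝ) ^ δ := Real.rpow_pos_of_pos hs' δ
    have hτK : 1 / (K * (s : ℝ) ^ δ) ≤ ε / Δ := by
      rw [div_le_div_iff₀ (by positivity) hΔ]
      linarith
    -- The lower bound on `ε / Δ` just found exceeds `C' s / d`, so the second regime applies.
    refine le_trans ?_ (hlarge (lt_of_lt_of_le ?_ hτK))
    · calc _ = min (C' / 8) (1 / 2) / 3 * s * (1 / (K * (s : ℝ) ^ δ)) := by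
            rw [Real.rpow_sub hs', Real.rpow_one]
            field_simp
        _ ≤ _ := by gcongr
    · rw [Real.rpow_add hs', Real.rpow_one] at h₂
      rw [div_lt_div_iff₀ hd' (by positivity)]
      linarith
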